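/- Let $(A,\mu)$ be a Lie algebroid over a smooth manifold $M$, with anchor $\rho$ and bracket $[\,,]$ on $\Gamma(A)$. For $X,Y\in\Gamma(A)$ and $\xi,\eta\in\Gamma(A^*)$ let $\mathcal L_X\eta$ and $d\xi$ be the Lie derivative and the differential defined by $\mu$, i.e. $\langle\mathcal L_X\eta,Y\rangle=\rho(X)\langle\eta,Y\rangle-\langle\eta,[X,Y]\rangle$ and $(d\xi)(X,Y)=\rho(X)\langle\xi,Y\rangle-\rho(Y)\langle\xi,X\rangle-\langle\xi,[X,Y]\rangle$. The double of the trivial Lie bialgebroid $((A,\mu),(A^*,0))$ is the Courant algebroid $A\oplus A^*$ with the Dorfman bracket $$[X+\xi,Y+\eta]=[X,Y]+\mathcal L_X\eta-i_Y\,d\xi .$$ For a bracket $[\,,]$ and an endomorphism $\mathcal N$ put $[u,v]_{\mathcal N}=[\mathcal Nu,v]+[u,\mathcal Nv]-\mathcal N[u,v]$; the torsion of $\mathcal N$ is $T(\mathcal N)(u,v)=[\mathcal Nu,\mathcal Nv]-\mathcal N[u,v]_{\mathcal N}$. Let $N$ be a vector bundle endomorphism of $A$ that is proportional to an almost cps structure,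 i.e. $N=cJ$ with $c\in\mathbb R$ and $J^2=\varepsilon\,\mathrm{Id}_A$ for some $\varepsilon\in\{-1,1,0\}$. Let $\pi$ be a bivector on $A$, regarded as a skew-symmetric map $\pi:A^*\to A$ with $\pi(\xi,\eta)=\langle\pi\xi,\eta\rangle$, such that $N\pi=\pi\,{}^tN$. Consider the endomorphism $$\mathcal N=\begin{pmatrix}N&\pi\\0&-{}^tN\end{pmatrix}$$ of $A\oplus A^*$. Then the torsion of $\mathcal N$ with respect to the Dorfman bracket vanishes on all pairs of sections of $A\oplus A^*$ if and only if $(\pi,N)$ is a Poisson–Nijenhuis structure on $(A,\mu)$, that is, if and only if 1. $\pi$ is a Poisson bivector, $[\pi,\pi]^\mu=0$ for the Schouten–Nijenhuis bracket; 2. the torsion of $N$ with respect to $[\,,]$ vanishes; 3. $\pi$ and $N$ are compatible: $N\pi=\pi\,{}^tN$ and $C_\mu(\pi,N)=0$, where $$C_\mu(\pi,N)(\xi,\eta)=[\xi,\eta]^{\mu_N}_\pi-\big([{}^tN\xi,\eta]^\mu_\pi+[\xi,{}^tN\eta]^\mu_\pi-{}^tN[\xi,\eta]^\mu_\pi\big).$$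 Here $[\xi,\eta]^\mu_\pi=\mathcal L_{\pi\xi}\eta-\mathcal L_{\pi\eta}\xi-d(\pi(\xi,\eta))$, and $[\,,]^{\mu_N}_\pi$ is given by the same formula with $\mu$ replaced by $\mu_N$, which has anchor $\rho\circ N$ and bracket $[\,,]_N$ on $\Gamma(A)$. -/

import Mathlib

open Bundle
open scoped Manifold ContDiff Topology Bundle

set_option linter.unusedSectionVars false

/-! Lie algebroids over a smooth manifold `M` modelled on `E`.  A vector bundle `A` over `M` with
typical fibre `F` is given by its fibres `V x`, in Mathlib's sense. -/

namespace LieAlgd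

noncomputable section

variable (E : Type*) [NormedAddCommGroup E] [NormedSpace ℝ E]
  {M : Type*} [TopologicalSpace M] [ChartedSpace E M]
  (F : Type*) [NormedAddCommGroup F] [NormedSpace ℝ F]
  (V : M → Type*) [TopologicalSpace (TotalSpace F V)]
  [∀ x, AddCommGroup (V x)] [∀ x, Module ℝ (V x)] [∀ x, TopologicalSpace (V x)]
  [∀ x, IsTopologicalAddGroup (V x)] [∀ x, ContinuousSMul ℝ (V x)]
  [FiberBundle F V] [VectorBundle ℝ F V]

/-- Smooth real functions on `M`. -/
abbrev Fn (M : Type*) [TopologicalSpace M] [ChartedSpace E M] : Type _ := C^∞⟮𝓘(ℝ, E), M; ℝ⟯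

/-- Smooth sections of the bundle `A`. -/
abbrev Sec : Type _ := Cₛ^∞⟮𝓘(ℝ, E); F, V⟯

/-- Smooth sections of the dual bundle `A^*`. -/
abbrev Form : Type _ := Cₛ^∞⟮𝓘(ℝ, E); F →L[ℝ] ℝ, fun x => V x →L[ℝ] ℝ⟯

/-- Smooth vector bundle endomorphisms of `A` (over the identity of `M`). -/
abbrev Endo : Type _ := Cₛ^∞⟮𝓘(ℝ, E); F →L[ℝ] F, fun x => V x →L[ℝ] V x⟯

/-- Smooth vector bundle maps `A^* → A`. -/
abbrev DualHom : Type _ :=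
  Cₛ^∞⟮𝓘(ℝ, E); (F →L[ℝ] ℝ) →L[ℝ] F, fun x => (V x →L[ℝ] ℝ) →L[ℝ] V x⟯

/-- Smooth vector bundle maps `A → TM`. -/
abbrev AnchorMap [IsManifold 𝓘(ℝ, E) ∞ M] : Type _ :=
  Cₛ^∞⟮𝓘(ℝ, E); F →L[ℝ] E, fun x => V x →L[ℝ] TangentSpace 𝓘(ℝ, E) x⟯

/-- A bivector `P` on `A`, as a skew-symmetric vector bundle map `A^* → A`, where
`P(ξ, η) = ⟨P ξ, η⟩`. -/
structure Bivector where
  /-- the underlying bundle map -/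
  sharp : DualHom E F V
  skew : ∀ (x : M) (α β : V x →L[ℝ] ℝ), β (sharp x α) = -α (sharp x β)

variable {E F V}

/-- The product `f X` of a function and a section of `A`. -/
def smulFn (f : Fn E M) (X : Sec E F V) : Sec E F V :=
  ⟨fun x => f x • X x, f.contMDiff.smul_section X.contMDiff⟩

/-- The duality pairing `⟨ξ, X⟩` of a section of `A^*` and a section of `A`. -/
def pair (ξ : Form E F V) (X : Sec E F V) : Fn E M :=
  ⟨fun x => ξ x (X x), by
    have h := ContMDiff.clm_bundle_apply (F₁ := F) (F₂ := ℝ) (E₁ := V)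
      (E₂ := Bundle.Trivial M ℝ) (b := fun x : M => x) ξ.contMDiff X.contMDiff
    intro x
    have h' := h x
    rw [contMDiffAt_totalSpace] at h'
    exact h'.2⟩

/-- The section `N X` of `A`. -/
def applyEndo (N : Endo E F V) (X : Sec E F V) : Sec E F V :=
  ⟨fun x => N x (X x), N.contMDiff.clm_bundle_apply X.contMDiff⟩

/-- The section `P ξ` of `A`. -/
def applySharp (P : DualHom E F V) (ξ : Form E F V) : Sec E F V :=
  ⟨fun x => P x (ξ x), P.contMDiff.clm_bundle_apply ξ.contMDiff⟩

variable [IsManifold 𝓘(ℝ, E) ∞ M]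

/-- The derivative of the function `f` along the vector field `a(X)`. -/
def anchorDeriv (a : AnchorMap E F V) (X : Sec E F V) (f : Fn E M) : Fn E M :=
  ⟨fun x => mvfderiv 𝓘(ℝ, E) f x (a x (X x)), by
    have h1 := a.contMDiff.clm_bundle_apply X.contMDiff
    have h2 := (f.contMDiff.contMDiff_tangentMap (m := ∞) (by simp)).comp h1
    exact (contMDiff_snd_tangentBundle_modelSpace ℝ 𝓘(ℝ, ℝ)).comp h2⟩

variable (E F V) in
/-- An anchored bundle `ρ : A → TM` with a skew-symmetric `ℝ`-bilinear bracket on sections that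
obeys the Leibniz rule `[X, f Y] = f [X, Y] + (ρ(X) f) Y`; the Jacobi identity is not required. -/
structure SkewAlgebroid where
  /-- the anchor -/
  anchor : AnchorMap E F V
  /-- the bracket of sections -/
  bracket : Sec E F V →ₗ[ℝ] Sec E F V →ₗ[ℝ] Sec E F V
  bracket_self : ∀ X, bracket X X = 0
  leibniz : ∀ (X Y : Sec E F V) (f : Fn E M),
    bracket X (smulFn f Y) = smulFn f (bracket X Y) + smulFn (anchorDeriv anchor X f) Y

variable (E F V) in
/-- A Lie algebroid `(A, μ)`. -/
structure LieAlgebroid extends SkewAlgebroid E F V where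
  jacobi : ∀ X Y Z : Sec E F V,
    bracket X (bracket Y Z) = bracket (bracket X Y) Z + bracket Y (bracket X Z)

variable [FiniteDimensional ℝ E] [T2Space M] [FiniteDimensional ℝ F]
  [ContMDiffVectorBundle ∞ F V 𝓘(ℝ, E)]

/-- Near every point there are global smooth sections that form a frame, together with a bump
function `ψ` such that `ψ² X` is a combination of them with smooth coefficients. -/
theorem exists_localData (x₀ : M) : ∃ (ψ : Fn E M) (s : Fin (Module.finrank ℝ F) → Sec E F V)
    (c : Sec E F V → Fin (Module.finrank ℝ F) → Fn E M),
    (∀ᶠ x in 𝓝 x₀, ψ x = 1) ∧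
    (∀ X x, ψ x • ψ x • X x = ∑ i, c X i x • s i x) ∧
    (∀ X, X x₀ = 0 → ∀ i, c X i x₀ = 0) ∧
    (∀ᶠ x in 𝓝 x₀, ∀ i, s i x =
      (trivializationAt F V x₀).symmL ℝ x (Module.finBasis ℝ F i)) := by
  classical
  have : ContMDiffVectorBundle 1 F V 𝓘(ℝ, E) := ContMDiffVectorBundle.of_le (n := ∞) (by simp)
  let t := trivializationAt F V x₀
  let b := Module.finBasis ℝ F
  have hx₀ : x₀ ∈ t.baseSet := FiberBundle.mem_baseSet_trivializationAt F V x₀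
  obtain ⟨f, -, hf⟩ := (SmoothBumpFunction.nhds_basis_tsupport (I := 𝓘(ℝ, E)) x₀).mem_iff.1
    (t.open_baseSet.mem_nhds hx₀)
  have hfs : tsupport (f : M → ℝ) ⊆ t.baseSet := hf
  refine ⟨⟨f, f.contMDiff⟩, fun i => ⟨(f : M → ℝ) • t.localFrame b i, ?_⟩,
    fun X i => ⟨fun x => f x * t.localFrameCoeff 𝓘(ℝ, E) b i x (X x), ?_⟩, ?_, ?_, ?_, ?_⟩
  · exact f.contMDiff.contMDiffOn.smul_section_of_tsupport t.open_baseSet hfs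
      (t.contMDiffOn_localFrame_baseSet ∞ b i)
  · refine contMDiff_of_tsupport fun x hx => ?_
    have hxb : x ∈ t.baseSet := hfs (closure_mono (fun y hy => left_ne_zero_of_mul hy) hx)
    exact f.contMDiffAt.mul
      (contMDiffAt_localFrameCoeff b hxb X.contMDiff.contMDiffAt i)
  · exact f.eventuallyEq_one
  · intro X x
    by_cases hx : x ∈ t.baseSet
    · have := t.eq_sum_localFrameCoeff_smul (I := 𝓘(ℝ, E)) (b := b) (s := X) hx
      conv_lhs => rw [this]
      simp only [Finset.smul_sum, ContMDiffMap.coeFn_mk, ContMDiffSection.coeFn_mk,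
        Pi.smul_apply', smul_smul]
      exact Finset.sum_congr rfl fun i _ => by congr 1; ring
    · have : f x = 0 := image_eq_zero_of_notMem_tsupport fun h => hx (hfs h)
      simp [this]
  · intro X hX i
    simp [hX]
  · filter_upwards [f.eventuallyEq_one, t.open_baseSet.mem_nhds hx₀] with x hx hxb i
    simp [hx, hxb, Bundle.Trivialization.basisAt, b, t, Bundle.Trivialization.linearEquivAt_symm_apply]

/-- Every vector of the bundle is the value of a global smooth section. -/
theorem exists_eval_eq (x₀ : M) (v : V x₀) : ∃ X : Sec E F V, X x₀ = v := by
  obtain ⟨ψ, s, c, h1, h2, h3, h4⟩ := exists_localData (V := V) (F := F) (E := E) x₀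
  have hx₀ := FiberBundle.mem_baseSet_trivializationAt F V x₀
  let t := trivializationAt F V x₀
  let b := Module.finBasis ℝ F
  refine ⟨∑ i, b.repr (t.continuousLinearMapAt ℝ x₀ v) i • s i, ?_⟩
  rw [← ContMDiffSection.coeAddHom_apply, map_sum, Finset.sum_apply]
  have h (i) : s i x₀ = t.symmL ℝ x₀ (b i) := by
    exact h4.self_of_nhds i
  simp only [ContMDiffSection.coeAddHom_apply, ContMDiffSection.coe_smul, Pi.smul_apply, h]
  rw [← t.symmL_continuousLinearMapAt (R := ℝ) hx₀ v]
  conv_rhs => rw [← b.sum_repr (t.continuousLinearMapAt ℝ x₀ v)]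
  rw [map_sum]
  simp only [map_smul, t.symmL_continuousLinearMapAt (R := ℝ) hx₀ v]

/-- A family of covectors whose pairing with every smooth section is smooth is a smooth section of
the dual bundle. -/
theorem contMDiff_form (ξ : ∀ x, V x →L[ℝ] ℝ)
    (h : ∀ X : Sec E F V, ContMDiff 𝓘(ℝ, E) 𝓘(ℝ, ℝ) ∞ fun x => ξ x (X x)) :
    ContMDiff 𝓘(ℝ, E) (𝓘(ℝ, E).prod 𝓘(ℝ, F →L[ℝ] ℝ)) ∞
      fun x => TotalSpace.mk' (F →L[ℝ] ℝ) (E := fun x => V x →L[ℝ] ℝ) x (ξ x) := by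
  intro x₀
  refine (contMDiffAt_hom_bundle (E₂ := Bundle.Trivial M ℝ) _).2 ⟨contMDiffAt_id, ?_⟩
  obtain ⟨ψ, s, c, h1, h2, h3, h4⟩ := exists_localData (V := V) (F := F) (E := E) x₀
  have hx₀ := FiberBundle.mem_baseSet_trivializationAt F V x₀
  let b := Module.finBasis ℝ F
  have : ContMDiffAt 𝓘(ℝ, E) 𝓘(ℝ, F →L[ℝ] ℝ) ∞
      (fun x => ∑ i, ξ x (s i x) • (b.coord i).toContinuousLinearMap) x₀ :=
    contMDiffAt_finsetSum fun i _ => (h (s i)).contMDiffAt.smul contMDiffAt_const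
  refine this.congr_of_eventuallyEq ?_
  filter_upwards [h4, (trivializationAt F V x₀).open_baseSet.mem_nhds hx₀] with x hx hxb
  refine ContinuousLinearMap.coe_injective (b.ext fun j => ?_)
  simp [ContinuousLinearMap.inCoordinates, hx, b, Finsupp.single_apply]

/-- A `C^∞(M)`-linear map from sections of `A` to functions is the pairing with a section of
`A^*`. -/
theorem exists_form (Φ : Sec E F V → Fn E M) (hadd : ∀ X Y, Φ (X + Y) = Φ X + Φ Y)
    (hsmul : ∀ (f : Fn E M) X, Φ (smulFn f X) = f * Φ X) :
    ∃ ξ : Form E F V, ∀ X, pair ξ X = Φ X := by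
  classical
  have hz : Φ 0 = 0 := by simpa using hadd 0 0
  have hsum : ∀ {ι : Type} (s : Finset ι) (g : ι → Sec E F V),
      Φ (∑ i ∈ s, g i) = ∑ i ∈ s, Φ (g i) := by
    intro ι s g
    induction s using Finset.induction_on with
    | empty => simpa using hz
    | insert a s ha ih => rw [Finset.sum_insert ha, Finset.sum_insert ha, hadd, ih]
  have hpt : ∀ (x : M) (X : Sec E F V), X x = 0 → Φ X x = 0 := by
    intro x X hX
    obtain ⟨ψ, s, c, h1, h2, h3, h4⟩ := exists_localData (V := V) (F := F) (E := E) x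
    have key : smulFn ψ (smulFn ψ X) = ∑ i, smulFn (c X i) (s i) := by
      apply ContMDiffSection.coe_injective
      rw [← ContMDiffSection.coeAddHom_apply (s := ∑ i, _), map_sum]
      funext y
      simpa [smulFn] using h2 X y
    have e := congrArg (fun f : Fn E M => f x) (congrArg Φ key)
    rw [hsum] at e
    simp only [hsmul] at e
    have hψ : ψ x = 1 := h1.self_of_nhds
    have hr : (∑ i, c X i * Φ (s i)) x = 0 := by
      change ContMDiffMap.evalRingHom x (∑ i, c X i * Φ (s i)) = 0
      rw [map_sum]
      exact Finset.sum_eq_zero fun i _ => by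
        change c X i x * Φ (s i) x = 0
        rw [h3 X hX i, zero_mul]
    rw [hr] at e
    simpa [hψ] using e
  choose ext hext using fun (x : M) (v : V x) => exists_eval_eq (E := E) (F := F) x v
  have hpt' : ∀ (x : M) (X Y : Sec E F V), X x = Y x → Φ X x = Φ Y x := by
    intro x X Y hXY
    have h0 := hpt x (X - Y) (by simp [hXY])
    have h1 := hadd (X - Y) Y
    rw [sub_add_cancel] at h1
    rw [h1]
    simp [h0]
  let ξ : ∀ x, V x →L[ℝ] ℝ := fun x =>
    have : T2Space (V x) := FiberBundle.t2Space F V x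
    have : FiniteDimensional ℝ (V x) := VectorBundle.finiteDimensional ℝ F V x
    LinearMap.toContinuousLinearMap
    { toFun := fun v => Φ (ext x v) x
      map_add' := fun v w => by
        have := congrArg (fun f : Fn E M => f x) (hadd (ext x v) (ext x w))
        rw [hpt' x (ext x (v + w)) (ext x v + ext x w) (by simp [hext])]
        simpa using this
      map_smul' := fun a v => by
        have := congrArg (fun f : Fn E M => f x)
          (hsmul (ContMDiffMap.const a) (ext x v))
        rw [hpt' x (ext x (a • v)) (smulFn (ContMDiffMap.const a) (ext x v))
          (by rw [hext]; change _ = a • ext x v x; rw [hext])]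
        exact this }
  have hξ : ∀ (X : Sec E F V) x, ξ x (X x) = Φ X x := fun X x => hpt' x _ _ (hext x _)
  refine ⟨⟨ξ, contMDiff_form ξ fun X => ?_⟩, fun X => ?_⟩
  · simp only [hξ]
    exact (Φ X).contMDiff
  · ext x
    exact hξ X x

/-- The transpose of `N` on sections of `A^*`: `⟨ᵗN ξ, X⟩ = ⟨ξ, N X⟩`. -/
def applyTranspose (N : Endo E F V) (ξ : Form E F V) : Form E F V :=
  ⟨fun x => (ξ x).comp (N x), contMDiff_form _ fun X => (pair ξ (applyEndo N X)).contMDiff⟩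

/-! ### Algebra of sections -/

theorem smulFn_apply (f : Fn E M) (X : Sec E F V) (x : M) : smulFn f X x = f x • X x := rfl

theorem pair_apply (ξ : Form E F V) (X : Sec E F V) (x : M) : pair ξ X x = ξ x (X x) := rfl

theorem pair_add (ξ : Form E F V) (X Y : Sec E F V) :
    pair ξ (X + Y) = pair ξ X + pair ξ Y := by
  ext x
  exact map_add (ξ x) (X x) (Y x)

theorem pair_sub (ξ : Form E F V) (X Y : Sec E F V) :
    pair ξ (X - Y) = pair ξ X - pair ξ Y := by
  ext x
  exact map_sub (ξ x) (X x) (Y x)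

theorem pair_smulFn (ξ : Form E F V) (f : Fn E M) (X : Sec E F V) :
    pair ξ (smulFn f X) = f * pair ξ X := by
  ext x
  exact map_smul (ξ x) (f x) (X x)

theorem applyEndo_add (N : Endo E F V) (X Y : Sec E F V) :
    applyEndo N (X + Y) = applyEndo N X + applyEndo N Y := by
  ext x
  exact map_add (N x) (X x) (Y x)

theorem applyEndo_smul (N : Endo E F V) (c : ℝ) (X : Sec E F V) :
    applyEndo N (c • X) = c • applyEndo N X := by
  ext x
  exact map_smul (N x) c (X x)

theorem applyEndo_smulFn (N : Endo E F V) (f : Fn E M) (X : Sec E F V) :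
    applyEndo N (smulFn f X) = smulFn f (applyEndo N X) := by
  ext x
  exact map_smul (N x) (f x) (X x)

theorem anchorDeriv_add_left (a : AnchorMap E F V) (X Y : Sec E F V) (f : Fn E M) :
    anchorDeriv a (X + Y) f = anchorDeriv a X f + anchorDeriv a Y f := by
  ext x
  change mvfderiv 𝓘(ℝ, E) f x (a x (X x + Y x)) =
    mvfderiv 𝓘(ℝ, E) f x (a x (X x)) + mvfderiv 𝓘(ℝ, E) f x (a x (Y x))
  rw [map_add, map_add]

theorem anchorDeriv_smulFn_left (a : AnchorMap E F V) (g : Fn E M) (X : Sec E F V) (f : Fn E M) :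
    anchorDeriv a (smulFn g X) f = g * anchorDeriv a X f := by
  ext x
  change mvfderiv 𝓘(ℝ, E) f x (a x (g x • X x)) = g x * mvfderiv 𝓘(ℝ, E) f x (a x (X x))
  rw [map_smul, map_smul, smul_eq_mul]

theorem mdifferentiableAt_fn (f : Fn E M) (x : M) :
    MDifferentiableAt 𝓘(ℝ, E) 𝓘(ℝ, ℝ) f x :=
  f.contMDiff.mdifferentiable (by simp) x

theorem anchorDeriv_add (a : AnchorMap E F V) (X : Sec E F V) (f g : Fn E M) :
    anchorDeriv a X (f + g) = anchorDeriv a X f + anchorDeriv a X g := by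
  ext x
  change mvfderiv 𝓘(ℝ, E) (⇑f + ⇑g) x (a x (X x)) =
    mvfderiv 𝓘(ℝ, E) f x (a x (X x)) + mvfderiv 𝓘(ℝ, E) g x (a x (X x))
  rw [mvfderiv_add (mdifferentiableAt_fn f x) (mdifferentiableAt_fn g x)]
  rfl

theorem anchorDeriv_mul (a : AnchorMap E F V) (X : Sec E F V) (f g : Fn E M) :
    anchorDeriv a X (f * g) = f * anchorDeriv a X g + g * anchorDeriv a X f := by
  ext x
  change mvfderiv 𝓘(ℝ, E) (⇑f * ⇑g) x (a x (X x)) =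
    f x * mvfderiv 𝓘(ℝ, E) g x (a x (X x)) + g x * mvfderiv 𝓘(ℝ, E) f x (a x (X x))
  rw [mvfderiv_mul (mdifferentiableAt_fn f x) (mdifferentiableAt_fn g x)]
  simp

/-! ### Torsion, for an arbitrary bracket -/

/-- The deformed bracket `[u, v]_N = [N u, v] + [u, N v] - N [u, v]`. -/
def deformedBracket {W : Type*} [AddCommGroup W] (br : W → W → W) (N : W → W) (u v : W) : W :=
  br (N u) v + br u (N v) - N (br u v)

/-- The Nijenhuis torsion `[N u, N v] - N [u, v]_N`. -/
def torsion {W : Type*} [AddCommGroup W] (br : W → W → W) (N : W → W) (u v : W) : W :=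
  br (N u) (N v) - N (deformedBracket br N u v)

/-! ### Almost cps structures -/

/-- `J² = ε Id` with `ε ∈ {-1, 1, 0}`. -/
def IsAlmostCps (J : Endo E F V) : Prop :=
  ∃ ε : ℝ, (ε = -1 ∨ ε = 1 ∨ ε = 0) ∧ ∀ (x : M) (v : V x), J x (J x v) = ε • v

/-- `N` is a real multiple of an almost cps structure. -/
def IsProportionalToAlmostCps (N : Endo E F V) : Prop :=
  ∃ (c : ℝ) (J : Endo E F V), IsAlmostCps J ∧ N = c • J

/-- The condition `N P = P ᵗN`. -/
def Intertwines (N : Endo E F V) (P : Bivector E F V) : Prop :=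
  ∀ (x : M) (α : V x →L[ℝ] ℝ), N x (P.sharp x α) = P.sharp x (α.comp (N x))

/-! ### Calculus on a Lie algebroid -/

namespace SkewAlgebroid

variable (L : SkewAlgebroid E F V)

/-- `ρ(X) f`. -/
def rho (X : Sec E F V) (f : Fn E M) : Fn E M := anchorDeriv L.anchor X f

theorem leibniz_left (X Y : Sec E F V) (f : Fn E M) :
    L.bracket (smulFn f X) Y = smulFn f (L.bracket X Y) - smulFn (L.rho Y f) X := by
  have skew (X Y : Sec E F V) : L.bracket X Y = -L.bracket Y X := by
    have h := L.bracket_self (X + Y)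
    simp only [map_add, LinearMap.add_apply, L.bracket_self, zero_add, add_zero] at h
    exact eq_neg_of_add_eq_zero_right h
  rw [skew, L.leibniz, skew Y X]
  ext x
  change -(f x • -(L.bracket X Y x) + L.rho Y f x • X x) =
    f x • L.bracket X Y x - L.rho Y f x • X x
  rw [smul_neg]
  abel

theorem exists_lieForm (X : Sec E F V) (η : Form E F V) : ∃ ζ : Form E F V,
    ∀ Y, pair ζ Y = L.rho X (pair η Y) - pair η (L.bracket X Y) := by
  refine exists_form _ (fun Y Z => ?_) fun f Y => ?_
  · rw [pair_add, map_add, pair_add, rho, anchorDeriv_add]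
    simp only [rho]
    ring
  · rw [pair_smulFn, L.leibniz, pair_add, pair_smulFn, pair_smulFn, rho, anchorDeriv_mul]
    simp only [rho]
    ring

/-- The Lie derivative `L_X η`, determined by `⟨L_X η, Y⟩ = ρ(X)⟨η, Y⟩ - ⟨η, [X, Y]⟩`. -/
def lieForm (X : Sec E F V) (η : Form E F V) : Form E F V := (L.exists_lieForm X η).choose

theorem pair_lieForm (X : Sec E F V) (η : Form E F V) (Y : Sec E F V) :
    pair (L.lieForm X η) Y = L.rho X (pair η Y) - pair η (L.bracket X Y) :=
  (L.exists_lieForm X η).choose_spec Y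

/-- The differential of a 1-form,
`(dξ)(Y, Z) = ρ(Y)⟨ξ, Z⟩ - ρ(Z)⟨ξ, Y⟩ - ⟨ξ, [Y, Z]⟩`. -/
def dForm (ξ : Form E F V) (Y Z : Sec E F V) : Fn E M :=
  L.rho Y (pair ξ Z) - L.rho Z (pair ξ Y) - pair ξ (L.bracket Y Z)

theorem exists_contraction (Y : Sec E F V) (ξ : Form E F V) : ∃ ζ : Form E F V,
    ∀ Z, pair ζ Z = L.dForm ξ Y Z := by
  refine exists_form _ (fun Z W => ?_) fun f Z => ?_
  · simp only [dForm, rho]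
    rw [pair_add, map_add, pair_add, anchorDeriv_add, anchorDeriv_add_left]
    ring
  · simp only [dForm, rho]
    rw [pair_smulFn, L.leibniz, pair_add, pair_smulFn, pair_smulFn, anchorDeriv_mul,
      anchorDeriv_smulFn_left]
    ring

/-- The contraction `i_Y dξ`, determined by `⟨i_Y dξ, Z⟩ = (dξ)(Y, Z)`. -/
def contraction (Y : Sec E F V) (ξ : Form E F V) : Form E F V := (L.exists_contraction Y ξ).choose

theorem pair_contraction (Y : Sec E F V) (ξ : Form E F V) (Z : Sec E F V) :
    pair (L.contraction Y ξ) Z = L.dForm ξ Y Z :=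
  (L.exists_contraction Y ξ).choose_spec Z

theorem exists_dFn (f : Fn E M) : ∃ ζ : Form E F V, ∀ Z, pair ζ Z = L.rho Z f :=
  exists_form _ (fun Z W => anchorDeriv_add_left _ Z W f)
    fun g Z => anchorDeriv_smulFn_left _ g Z f

/-- The differential of a function, determined by `⟨df, Z⟩ = ρ(Z) f`. -/
def dFn (f : Fn E M) : Form E F V := (L.exists_dFn f).choose

theorem pair_dFn (f : Fn E M) (Z : Sec E F V) : pair (L.dFn f) Z = L.rho Z f :=
  (L.exists_dFn f).choose_spec Z

/-- The bracket on sections of `A^*` defined by a bivector,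
`[ξ, η]_P = L_{Pξ} η - L_{Pη} ξ - d(P(ξ, η))`. -/
def koszul (P : Bivector E F V) (ξ η : Form E F V) : Form E F V :=
  L.lieForm (applySharp P.sharp ξ) η - L.lieForm (applySharp P.sharp η) ξ
    - L.dFn (pair η (applySharp P.sharp ξ))

/-- Auxiliary, not skew-symmetrized term of the Schouten–Nijenhuis bracket. -/
def schoutenTerm (P Q : Form E F V → Sec E F V) (ξ η ζ : Form E F V) : Fn E M :=
  L.rho (P ξ) (pair η (Q ζ)) + pair ζ (L.bracket (P ξ) (Q η))

/-- The Schouten–Nijenhuis bracket of two bivectors, as a trivector evaluated on 1-forms: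
`[P, Q](ξ, η, ζ)` is the sum over the cyclic permutations of `(ξ, η, ζ)` of
`ρ(Pξ) Q(ζ, η) + ⟨ζ, [Pξ, Qη]⟩ + ρ(Qξ) P(ζ, η) + ⟨ζ, [Qξ, Pη]⟩`.
It extends the bracket of sections: `[X ∧ Y, Z ∧ W] =
[X, Z] ∧ Y ∧ W - [X, W] ∧ Y ∧ Z - [Y, Z] ∧ X ∧ W + [Y, W] ∧ X ∧ Z`. -/
def schouten (P Q : Bivector E F V) (ξ η ζ : Form E F V) : Fn E M :=
  L.schoutenTerm (applySharp P.sharp) (applySharp Q.sharp) ξ η ζ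
    + L.schoutenTerm (applySharp P.sharp) (applySharp Q.sharp) η ζ ξ
    + L.schoutenTerm (applySharp P.sharp) (applySharp Q.sharp) ζ ξ η
    + L.schoutenTerm (applySharp Q.sharp) (applySharp P.sharp) ξ η ζ
    + L.schoutenTerm (applySharp Q.sharp) (applySharp P.sharp) η ζ ξ
    + L.schoutenTerm (applySharp Q.sharp) (applySharp P.sharp) ζ ξ η

/-- The composition `ρ ∘ N`. -/
def deformedAnchor (N : Endo E F V) : AnchorMap E F V :=
  ⟨fun x => (L.anchor x).comp (N x), by
    intro x₀
    obtain ⟨-, h1⟩ := (contMDiffAt_hom_bundle _).1 (L.anchor.contMDiff x₀)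
    obtain ⟨-, h2⟩ := (contMDiffAt_hom_bundle _).1 (N.contMDiff x₀)
    refine (contMDiffAt_hom_bundle _).2 ⟨contMDiffAt_id, (h1.clm_comp h2).congr_of_eventuallyEq ?_⟩
    filter_upwards [(trivializationAt F V x₀).open_baseSet.mem_nhds
      (FiberBundle.mem_baseSet_trivializationAt F V x₀)] with x hx
    ext v
    simp [ContinuousLinearMap.inCoordinates, hx]⟩

/-- The deformed structure `μ_N`, with anchor `ρ ∘ N` and bracket `[ , ]_N`. -/
def deform (N : Endo E F V) : SkewAlgebroid E F V where
  anchor := L.deformedAnchor N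
  bracket := LinearMap.mk₂ ℝ (deformedBracket (fun X Y => L.bracket X Y) (applyEndo N))
    (fun X Y Z => by simp only [deformedBracket, applyEndo_add, map_add, LinearMap.add_apply]; abel)
    (fun c X Y => by
      simp only [deformedBracket, applyEndo_smul, map_smul, LinearMap.smul_apply, smul_add,
        smul_sub])
    (fun X Y Z => by simp only [deformedBracket, applyEndo_add, map_add]; abel)
    (fun c X Y => by simp only [deformedBracket, applyEndo_smul, map_smul, smul_add, smul_sub])
  bracket_self X := by
    have h := L.bracket_self (applyEndo N X + X)
    simp only [map_add, LinearMap.add_apply, L.bracket_self, zero_add, add_zero] at h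
    have h0 : applyEndo N (0 : Sec E F V) = 0 := by simpa using applyEndo_smul N 0 0
    simp only [LinearMap.mk₂_apply, deformedBracket, L.bracket_self, h0, sub_zero]
    rw [add_comm]
    exact h
  leibniz X Y f := by
    simp only [LinearMap.mk₂_apply, deformedBracket, applyEndo_smulFn, L.leibniz, applyEndo_add]
    ext x
    change _ = f x • (L.bracket (applyEndo N X) Y x + L.bracket X (applyEndo N Y) x
      - applyEndo N (L.bracket X Y) x) + anchorDeriv L.anchor (applyEndo N X) f x • Y x
    simp only [ContMDiffSection.coe_add, ContMDiffSection.coe_sub, Pi.add_apply, Pi.sub_apply,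
      smulFn_apply, smul_add, smul_sub]
    abel

/-- The compatibility tensor of `P` and `N`,
`C(P, N)(ξ, η) = [ξ, η]_P^{μ_N} - ([ξ, η]_P^μ)_{ᵗN}`: the difference of the bracket defined by `P`
and the deformed structure `μ_N`, and of the deformation by `ᵗN` of the bracket defined by `P`.
In terms of the big bracket this is `{P, {N, μ}} + {N, {P, μ}}`, as `{N, γ}` is the deformation of a
bracket `γ` on `A^*` by `-ᵗN`. -/
def concomitant (P : Bivector E F V) (N : Endo E F V) (ξ η : Form E F V) : Form E F V :=
  (L.deform N).koszul P ξ η - deformedBracket (L.koszul P) (applyTranspose N) ξ η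

end SkewAlgebroid

namespace LieAlgebroid

variable (L : LieAlgebroid E F V)

/-- `(P, N)` is a Poisson–Nijenhuis structure on the Lie algebroid. -/
structure IsPoissonNijenhuis (P : Bivector E F V) (N : Endo E F V) : Prop where
  poisson : ∀ ξ η ζ : Form E F V, L.schouten P P ξ η ζ = 0
  nijenhuis : ∀ X Y : Sec E F V, torsion (fun X Y => L.bracket X Y) (applyEndo N) X Y = 0
  intertwines : Intertwines N P
  compatible : ∀ ξ η : Form E F V, L.concomitant P N ξ η = 0

/-- The Dorfman bracket of the double `A ⊕ A^*` of the trivial Lie bialgebroid `((A, μ), (A^*, 0))`,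
`[X + ξ, Y + η] = [X, Y] + L_X η - i_Y dξ`. A section of `A ⊕ A^*` is a pair of sections. -/
def dorfman (u v : Sec E F V × Form E F V) : Sec E F V × Form E F V :=
  (L.bracket u.1 v.1, L.lieForm u.1 v.2 - L.contraction v.1 u.2)

end LieAlgebroid

/-- The endomorphism of `A ⊕ A^*` with matrix `[[N, P], [0, -ᵗN]]`, on sections. -/
def doubleEndo (N : Endo E F V) (P : Bivector E F V) (u : Sec E F V × Form E F V) :
    Sec E F V × Form E F V :=
  (applyEndo N u.1 + applySharp P.sharp u.2, -applyTranspose N u.2)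

end

end LieAlgd

namespace LieAlgd

noncomputable section

variable {E : Type*} [NormedAddCommGroup E] [NormedSpace ℝ E] [FiniteDimensional ℝ E]
  {M : Type*} [TopologicalSpace M] [T2Space M] [ChartedSpace E M] [IsManifold 𝓘(ℝ, E) ∞ M]
  {F : Type*} [NormedAddCommGroup F] [NormedSpace ℝ F] [FiniteDimensional ℝ F]
  {V : M → Type*} [TopologicalSpace (TotalSpace F V)]
  [∀ x, AddCommGroup (V x)] [∀ x, Module ℝ (V x)] [∀ x, TopologicalSpace (V x)]
  [∀ x, IsTopologicalAddGroup (V x)] [∀ x, ContinuousSMul ℝ (V x)]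
  [FiberBundle F V] [VectorBundle ℝ F V] [ContMDiffVectorBundle ∞ F V 𝓘(ℝ, E)]

/-! ### Nondegeneracy of the duality pairing -/

/-! Sections are detected by pairing with forms and forms by pairing with sections, so the torsion
of $\mathcal N$ on $(X+\xi, Y+\eta)$ is known from two families of functions, one for each
component. Write $T_N$ for the torsion of $N$, $J$ for half of $[\pi,\pi]$, and $C$ for half of
$C_\mu(\pi,N)$ paired with a section. Expanding the Lie derivatives and differentials gives

$\langle\zeta, T_1\rangle = \langle\zeta, T_N(X,Y)\rangle + J(\xi,\eta,\zeta) - C(\zeta,\eta;X) +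
C(\zeta,\xi;Y)$,

$\langle T_2, Z\rangle = C(\xi,\eta;Z) - \langle\eta, T_N(X,Z)\rangle + \langle\xi,
T_N(Y,Z)\rangle$.

These are `pair_torsion_fst` and `pair_torsion_snd`. If $T_N$, $J$ and $C$ vanish, so does the
torsion of $\mathcal N$. Conversely, two pure sections of $A$ isolate $T_N$ in the first component,
and two pure forms isolate $J$ in the first and $C$ in the second.

The first formula rests on $N\pi=\pi\,{}^tN$. The second rests on $N^2=\kappa\,\mathrm{Id}$ with
$\kappa$ a real constant: transposing the torsion leaves defects such as $\langle\eta,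
N^2[X,Z]-[X,N^2Z]\rangle$, which vanish because the bracket is $\mathbb R$-bilinear. -/

theorem form_eq_zero {ξ : Form E F V} (h : ∀ X : Sec E F V, pair ξ X = 0) : ξ = 0 := by
  ext x : 1
  refine ContinuousLinearMap.ext fun v => ?_
  obtain ⟨X, rfl⟩ := exists_eval_eq (E := E) (F := F) x v
  exact congrArg (fun f : Fn E M => f x) (h X)

/-- Covectors separate the points of a finite-dimensional fibre, and each covector is the value of a
global form. -/
theorem sec_eq_zero {X : Sec E F V} (h : ∀ ξ : Form E F V, pair ξ X = 0) : X = 0 := by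
  ext x
  have : T2Space (V x) := FiberBundle.t2Space F V x
  have : FiniteDimensional ℝ (V x) := VectorBundle.finiteDimensional ℝ F V x
  refine (Module.forall_dual_apply_eq_zero_iff ℝ (X x)).1 fun φ => ?_
  -- The extension result for vectors is applied to the dual bundle; an algebraic functional on the
  -- fibre is continuous by finite dimension.
  obtain ⟨ξ, hξ⟩ := exists_eval_eq (E := E) (F := F →L[ℝ] ℝ) (V := fun x => V x →L[ℝ] ℝ) x
    (LinearMap.toContinuousLinearMap φ)
  have := congrArg (fun f : Fn E M => f x) (h ξ)
  rw [pair_apply, hξ] at this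
  exact this

/-! ### Linearity of the operations on sections -/

theorem pair_add_left (ξ η : Form E F V) (X : Sec E F V) :
    pair (ξ + η) X = pair ξ X + pair η X := rfl

theorem pair_sub_left (ξ η : Form E F V) (X : Sec E F V) :
    pair (ξ - η) X = pair ξ X - pair η X := rfl

theorem pair_neg_left (ξ : Form E F V) (X : Sec E F V) : pair (-ξ) X = -pair ξ X := rfl

theorem pair_zero_left (X : Sec E F V) : pair (0 : Form E F V) X = 0 := rfl

theorem pair_zero (ξ : Form E F V) : pair ξ (0 : Sec E F V) = 0 := by
  simpa using pair_sub ξ 0 0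

theorem pair_neg (ξ : Form E F V) (X : Sec E F V) : pair ξ (-X) = -pair ξ X := by
  simpa [pair_zero] using pair_sub ξ 0 X

theorem pair_smul (ξ : Form E F V) (c : ℝ) (X : Sec E F V) :
    pair ξ (c • X) = c • pair ξ X := by
  ext x
  exact map_smul (ξ x) c (X x)

theorem pair_applyTranspose (N : Endo E F V) (ξ : Form E F V) (X : Sec E F V) :
    pair (applyTranspose N ξ) X = pair ξ (applyEndo N X) := rfl

theorem pair_applySharp (P : Bivector E F V) (ξ η : Form E F V) :
    pair ξ (applySharp P.sharp η) = -pair η (applySharp P.sharp ξ) := by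
  ext x
  exact P.skew x (η x) (ξ x)

theorem applyEndo_sub (N : Endo E F V) (X Y : Sec E F V) :
    applyEndo N (X - Y) = applyEndo N X - applyEndo N Y := by
  ext x
  exact map_sub (N x) (X x) (Y x)

theorem applyEndo_zero (N : Endo E F V) : applyEndo N (0 : Sec E F V) = 0 := by
  simpa using applyEndo_sub N 0 0

theorem applySharp_neg (P : DualHom E F V) (ξ : Form E F V) :
    applySharp P (-ξ) = -applySharp P ξ := by
  ext x
  exact map_neg (P x) (ξ x)

theorem applySharp_add (P : DualHom E F V) (ξ η : Form E F V) :
    applySharp P (ξ + η) = applySharp P ξ + applySharp P η := by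
  ext x
  exact map_add (P x) (ξ x) (η x)

theorem applySharp_sub (P : DualHom E F V) (ξ η : Form E F V) :
    applySharp P (ξ - η) = applySharp P ξ - applySharp P η := by
  ext x
  exact map_sub (P x) (ξ x) (η x)

theorem applySharp_zero (P : DualHom E F V) : applySharp P (0 : Form E F V) = 0 := by
  ext x
  exact map_zero (P x)

theorem Intertwines.applySharp_applyTranspose {N : Endo E F V} {P : Bivector E F V}
    (h : Intertwines N P) (ξ : Form E F V) :
    applySharp P.sharp (applyTranspose N ξ) = applyEndo N (applySharp P.sharp ξ) := by
  ext x
  exact (h x (ξ x)).symm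

/-- From $N=cJ$ comes $\kappa=c^2\varepsilon$. This is all that the proof takes from the cps
hypothesis; the particular values of $\varepsilon$ play no role. -/
theorem IsProportionalToAlmostCps.exists_sq {N : Endo E F V} (h : IsProportionalToAlmostCps N) :
    ∃ κ : ℝ, ∀ X : Sec E F V, applyEndo N (applyEndo N X) = κ • X := by
  obtain ⟨c, J, ⟨ε, -, hJ⟩, rfl⟩ := h
  refine ⟨c * c * ε, fun X => ?_⟩
  ext x
  change c • J x (c • J x (X x)) = (c * c * ε) • X x
  rw [map_smul, hJ, smul_smul, smul_smul]

/-! ### Anchor calculus, and the halved Schouten and compatibility tensors -/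

namespace SkewAlgebroid

variable (L : SkewAlgebroid E F V)

theorem bracket_skew (X Y : Sec E F V) : L.bracket X Y = -L.bracket Y X := by
  have h := L.bracket_self (X + Y)
  simp only [map_add, LinearMap.add_apply, L.bracket_self, zero_add, add_zero] at h
  exact eq_neg_of_add_eq_zero_right h

theorem pair_bracket_skew (ξ : Form E F V) (X Y : Sec E F V) :
    pair ξ (L.bracket X Y) = -pair ξ (L.bracket Y X) := by
  rw [L.bracket_skew, eq_neg_iff_add_eq_zero, ← pair_add, neg_add_cancel, pair_zero]

theorem pair_applyEndo_bracket_skew (N : Endo E F V) (ξ : Form E F V) (X Y : Sec E F V) :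
    pair ξ (applyEndo N (L.bracket X Y)) = -pair ξ (applyEndo N (L.bracket Y X)) :=
  L.pair_bracket_skew (applyTranspose N ξ) X Y

theorem rho_add (X : Sec E F V) (f g : Fn E M) : L.rho X (f + g) = L.rho X f + L.rho X g :=
  anchorDeriv_add _ _ _ _

theorem rho_zero (X : Sec E F V) : L.rho X 0 = 0 := by
  simpa using L.rho_add X 0 0

theorem rho_neg (X : Sec E F V) (f : Fn E M) : L.rho X (-f) = -L.rho X f := by
  rw [eq_neg_iff_add_eq_zero, ← rho_add, neg_add_cancel, rho_zero]

theorem rho_add_left (X Y : Sec E F V) (f : Fn E M) :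
    L.rho (X + Y) f = L.rho X f + L.rho Y f :=
  anchorDeriv_add_left _ _ _ _

theorem rho_zero_left (f : Fn E M) : L.rho 0 f = 0 := by
  simpa using L.rho_add_left 0 0 f

/-- A derivation kills constants. This lets the factor $\kappa$ coming from $N^2$ pass through the
anchor. -/
theorem rho_smul (c : ℝ) (X : Sec E F V) (f : Fn E M) :
    L.rho X (c • f) = c • L.rho X f := by
  have hc : L.rho X (ContMDiffMap.const c) = 0 := by
    ext x
    change mvfderiv 𝓘(ℝ, E) (fun _ : M => c) x (L.anchor x (X x)) = 0
    rw [mvfderiv_const]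
    rfl
  have hm (g : Fn E M) : c • g = (ContMDiffMap.const c : Fn E M) * g := by
    ext x
    rfl
  rw [rho] at hc
  rw [hm, hm, rho, anchorDeriv_mul, hc, mul_zero, add_zero]
  rfl

theorem pair_koszul (P : Bivector E F V) (ξ η : Form E F V) (Z : Sec E F V) :
    pair (L.koszul P ξ η) Z =
      L.rho (applySharp P.sharp ξ) (pair η Z) - pair η (L.bracket (applySharp P.sharp ξ) Z)
        - L.rho (applySharp P.sharp η) (pair ξ Z) + pair ξ (L.bracket (applySharp P.sharp η) Z)
        + L.rho Z (pair ξ (applySharp P.sharp η)) := by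
  rw [koszul, pair_sub_left, pair_sub_left, pair_lieForm, pair_lieForm, pair_dFn,
    pair_applySharp P ξ η, rho_neg]
  ring

/-- Half of the Schouten–Nijenhuis bracket of a bivector with itself. -/
def jacobiator (P : Bivector E F V) (ξ η ζ : Form E F V) : Fn E M :=
  L.schoutenTerm (applySharp P.sharp) (applySharp P.sharp) ξ η ζ
    + L.schoutenTerm (applySharp P.sharp) (applySharp P.sharp) η ζ ξ
    + L.schoutenTerm (applySharp P.sharp) (applySharp P.sharp) ζ ξ η

theorem schouten_self (P : Bivector E F V) (ξ η ζ : Form E F V) :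
    L.schouten P P ξ η ζ = (2 : ℝ) • L.jacobiator P ξ η ζ := by
  rw [two_smul, schouten, jacobiator]
  ring

/-- Half of the compatibility tensor of `P` and `N`, when `N P = P ᵗN`. -/
def mixedTerm (P : Bivector E F V) (N : Endo E F V) (ξ η : Form E F V) (Z : Sec E F V) : Fn E M :=
  L.rho (applyEndo N Z) (pair ξ (applySharp P.sharp η))
    - L.rho Z (pair ξ (applyEndo N (applySharp P.sharp η)))
    - pair η (L.bracket (applySharp P.sharp ξ) (applyEndo N Z))
    + pair η (applyEndo N (L.bracket (applySharp P.sharp ξ) Z))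
    + pair ξ (L.bracket (applySharp P.sharp η) (applyEndo N Z))
    - pair ξ (applyEndo N (L.bracket (applySharp P.sharp η) Z))

theorem jacobiator_zero (P : Bivector E F V) (ζ : Form E F V) : L.jacobiator P 0 0 ζ = 0 := by
  simp [jacobiator, schoutenTerm, applySharp_zero, pair_zero, pair_zero_left, rho_zero]

theorem mixedTerm_zero_middle (P : Bivector E F V) (N : Endo E F V) (ζ : Form E F V)
    (Z : Sec E F V) : L.mixedTerm P N ζ 0 Z = 0 := by
  simp [mixedTerm, applySharp_zero, applyEndo_zero, pair_zero, pair_zero_left, rho_zero]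

theorem mixedTerm_zero_right (P : Bivector E F V) (N : Endo E F V) (ξ η : Form E F V) :
    L.mixedTerm P N ξ η 0 = 0 := by
  simp [mixedTerm, applyEndo_zero, pair_zero, rho_zero_left]

theorem torsion_zero_left (N : Endo E F V) (Y : Sec E F V) :
    torsion (fun X Y => L.bracket X Y) (applyEndo N) 0 Y = 0 := by
  simp [torsion, deformedBracket, applyEndo_zero]

theorem deform_rho (N : Endo E F V) (X : Sec E F V) (f : Fn E M) :
    (L.deform N).rho X f = L.rho (applyEndo N X) f := rfl

theorem deform_bracket (N : Endo E F V) (X Y : Sec E F V) :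
    (L.deform N).bracket X Y =
      L.bracket (applyEndo N X) Y + L.bracket X (applyEndo N Y) - applyEndo N (L.bracket X Y) :=
  rfl

/-- With $\pi\,{}^tN=N\pi$, the derivatives and brackets along $N\pi\xi$ and $N\pi\eta$ cancel
between the two brackets on forms, as do terms like $\rho(\pi\xi)\langle\eta,NZ\rangle$. Each
surviving term occurs twice. -/
theorem pair_concomitant {P : Bivector E F V} {N : Endo E F V} (h : Intertwines N P)
    (ξ η : Form E F V) (Z : Sec E F V) :
    pair (L.concomitant P N ξ η) Z = (2 : ℝ) • L.mixedTerm P N ξ η Z := by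
  simp only [concomitant, deformedBracket, pair_sub_left, pair_add_left, pair_applyTranspose,
    pair_koszul, h.applySharp_applyTranspose, deform_rho, deform_bracket, pair_add, pair_sub,
    two_smul, mixedTerm]
  ring

end SkewAlgebroid

/-! ### The two components of the torsion on $A\oplus A^*$ -/

namespace LieAlgebroid

variable (L : LieAlgebroid E F V)

/-- On pure forms the component is $[\pi\xi,\pi\eta]-\pi[\xi,\eta]_\pi$, because $\mathcal
L_{\pi\xi}\eta-i_{\pi\eta}d\xi$ is the bracket defined by $\pi$; its pairing with $\zeta$ is the
cyclic sum. The terms mixing a section and a form give the compatibility tensor, with $\zeta$ as one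
of its form arguments. -/
theorem pair_torsion_fst {P : Bivector E F V} {N : Endo E F V} (h : Intertwines N P)
    (X Y : Sec E F V) (ξ η ζ : Form E F V) :
    pair ζ (torsion L.dorfman (doubleEndo N P) (X, ξ) (Y, η)).1 =
      pair ζ (torsion (fun X Y => L.bracket X Y) (applyEndo N) X Y) + L.jacobiator P ξ η ζ
        - L.mixedTerm P N ζ η X + L.mixedTerm P N ζ ξ Y := by
  -- Intertwining makes $N\pi$ skew as well.
  have hN (α β : Form E F V) : pair α (applyEndo N (applySharp P.sharp β)) =
      -pair β (applyEndo N (applySharp P.sharp α)) := by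
    rw [← pair_applyTranspose, pair_applySharp, h.applySharp_applyTranspose]
  -- Skewness moves $\pi$ onto the test form, so that the Lie derivative or contraction is evaluated
  -- on a section and its defining formula applies.
  have hA (α β : Form E F V) (Z : Sec E F V) : pair α (applySharp P.sharp (L.lieForm Z β)) =
      -(L.rho Z (pair β (applySharp P.sharp α)) -
        pair β (L.bracket Z (applySharp P.sharp α))) := by
    rw [pair_applySharp, SkewAlgebroid.pair_lieForm]
  have hB (α β : Form E F V) (Z : Sec E F V) : pair α (applySharp P.sharp (L.contraction Z β)) =
      -(L.dForm β Z (applySharp P.sharp α)) := by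
    rw [pair_applySharp, SkewAlgebroid.pair_contraction]
  -- The skew-symmetry rules at specific arguments fix one orientation of each pairing and bracket,
  -- so that `ring` recognises equal terms.
  simp only [torsion, deformedBracket, dorfman, doubleEndo, Prod.fst_add, Prod.fst_sub,
    Prod.snd_add, Prod.snd_sub, pair_add, pair_sub, applySharp_add, applySharp_sub, applySharp_neg,
    h.applySharp_applyTranspose, hA, hB, hN _ (L.lieForm _ _), hN _ (L.contraction _ _),
    pair_neg_left, pair_neg, pair_applyTranspose,
    SkewAlgebroid.pair_lieForm, SkewAlgebroid.pair_contraction, SkewAlgebroid.dForm,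
    SkewAlgebroid.mixedTerm, SkewAlgebroid.jacobiator, SkewAlgebroid.schoutenTerm,
    map_add, LinearMap.add_apply, applyEndo_add, applyEndo_sub, L.rho_add, L.rho_neg,
    L.rho_add_left, hN ζ ξ, hN ζ η, pair_applySharp P ζ ξ,
    pair_applySharp P ζ η, L.pair_bracket_skew _ (applySharp P.sharp ζ),
    L.pair_applyEndo_bracket_skew _ _ (applySharp P.sharp ζ),
    L.pair_applyEndo_bracket_skew _ _ (applySharp P.sharp η) X,
    L.pair_bracket_skew _ (applySharp P.sharp η) (applyEndo N X)]
  ring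

/-- The lower right block is minus the transpose of $N$, so its torsion is dual to that of $N$ up to
terms in $N^2$. Replacing $N^2$ by the constant $\kappa$ cancels those terms; the terms containing
$\pi$ form half of the compatibility tensor. -/
theorem pair_torsion_snd (P : Bivector E F V) {N : Endo E F V}
    {κ : ℝ} (hκ : ∀ X : Sec E F V, applyEndo N (applyEndo N X) = κ • X)
    (X Y Z : Sec E F V) (ξ η : Form E F V) :
    pair (torsion L.dorfman (doubleEndo N P) (X, ξ) (Y, η)).2 Z =
      L.mixedTerm P N ξ η Z - pair η (torsion (fun X Y => L.bracket X Y) (applyEndo N) X Z)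
        + pair ξ (torsion (fun X Y => L.bracket X Y) (applyEndo N) Y Z) := by
  simp only [torsion, deformedBracket, dorfman, doubleEndo, Prod.fst_add, Prod.fst_sub,
    Prod.snd_add, Prod.snd_sub,
    pair_add, pair_sub, pair_add_left, pair_sub_left, pair_neg_left, pair_applyTranspose,
    SkewAlgebroid.pair_lieForm, SkewAlgebroid.pair_contraction, SkewAlgebroid.dForm,
    SkewAlgebroid.mixedTerm, map_add, LinearMap.add_apply,
    applyEndo_add, applyEndo_sub, hκ, L.rho_add, L.rho_neg, L.rho_add_left, L.rho_smul, pair_smul]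
  simp only [smul_sub]
  ring

end LieAlgebroid

end

end LieAlgd

theorem proposition4p8
    {E : Type*} [NormedAddCommGroup E] [NormedSpace ℝ E] [FiniteDimensional ℝ E]
    {M : Type*} [TopologicalSpace M] [T2Space M] [ChartedSpace E M]
    [IsManifold 𝓘(ℝ, E) ∞ M]
    {F : Type*} [NormedAddCommGroup F] [NormedSpace ℝ F] [FiniteDimensional ℝ F]
    {V : M → Type*} [TopologicalSpace (TotalSpace F V)]
    [∀ x, AddCommGroup (V x)] [∀ x, Module ℝ (V x)] [∀ x, TopologicalSpace (V x)]
    [∀ x, IsTopologicalAddGroup (V x)] [∀ x, ContinuousSMul ℝ (V x)]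
    [FiberBundle F V] [VectorBundle ℝ F V] [ContMDiffVectorBundle ∞ F V 𝓘(ℝ, E)]
    (L : LieAlgd.LieAlgebroid E F V) (N : LieAlgd.Endo E F V) (P : LieAlgd.Bivector E F V)
    (hN : LieAlgd.IsProportionalToAlmostCps N) (hNP : LieAlgd.Intertwines N P) :
    (∀ u v : LieAlgd.Sec E F V × LieAlgd.Form E F V,
        LieAlgd.torsion L.dorfman (LieAlgd.doubleEndo N P) u v = 0) ↔
      L.IsPoissonNijenhuis P N := by
  obtain ⟨κ, hκ⟩ := hN.exists_sq
  constructor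
  · intro hT
    have h1 (u v) (ζ : LieAlgd.Form E F V) :
        LieAlgd.pair ζ (LieAlgd.torsion L.dorfman (LieAlgd.doubleEndo N P) u v).1 = 0 := by
      rw [hT]; exact LieAlgd.pair_zero ζ
    have h2 (u v) (Z : LieAlgd.Sec E F V) :
        LieAlgd.pair (LieAlgd.torsion L.dorfman (LieAlgd.doubleEndo N P) u v).2 Z = 0 := by
      rw [hT]; rfl
    refine ⟨fun ξ η ζ => ?_, fun X Y => LieAlgd.sec_eq_zero fun ζ => ?_, hNP, fun ξ η =>
      LieAlgd.form_eq_zero fun Z => ?_⟩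
    -- Two pure forms: only half of $[\pi,\pi]$ survives in the $A$-component.
    · have h := h1 (0, ξ) (0, η) ζ
      rw [L.pair_torsion_fst hNP, L.torsion_zero_left, L.mixedTerm_zero_right,
        L.mixedTerm_zero_right, LieAlgd.pair_zero] at h
      rw [L.schouten_self]
      simpa using h
    -- Two pure sections of $A$: only the torsion of $N$ survives.
    · have h := h1 (X, 0) (Y, 0) ζ
      rw [L.pair_torsion_fst hNP, L.jacobiator_zero, L.mixedTerm_zero_middle,
        L.mixedTerm_zero_middle] at h
      simpa using h
    -- Two pure forms again, now in the $A^*$-component: only half of the compatibility tensor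
    -- survives.
    · have h := h2 (0, ξ) (0, η) Z
      rw [L.pair_torsion_snd P hκ, L.torsion_zero_left, LieAlgd.pair_zero,
        LieAlgd.pair_zero] at h
      rw [L.pair_concomitant hNP]
      simpa using h
  · rintro ⟨hP, hT, -, hC⟩ ⟨X, ξ⟩ ⟨Y, η⟩
    have hM (ξ η : LieAlgd.Form E F V) (Z : LieAlgd.Sec E F V) : L.mixedTerm P N ξ η Z = 0 := by
      have h := L.pair_concomitant hNP ξ η Z
      rw [hC, LieAlgd.pair_zero_left] at h
      exact (smul_eq_zero.1 h.symm).resolve_left two_ne_zero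
    have hJ (ξ η ζ : LieAlgd.Form E F V) : L.jacobiator P ξ η ζ = 0 :=
      (smul_eq_zero.1 ((L.schouten_self P ξ η ζ).symm.trans (hP ξ η ζ))).resolve_left two_ne_zero
    refine Prod.ext (LieAlgd.sec_eq_zero fun ζ => ?_) (LieAlgd.form_eq_zero fun Z => ?_)
    · rw [L.pair_torsion_fst hNP, hT, hJ, hM, hM, LieAlgd.pair_zero]
      simp
    · rw [L.pair_torsion_snd P hκ, hT, hT, hM, LieAlgd.pair_zero, LieAlgd.pair_zero]
      simp
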